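/- A partition is a $3$-core if none of the hooks of its Young diagram consists of exactly $3$ boxes. Let $a_3(n)$ be the number of $3$-core partitions of $n$. For each diagonal box of the Young diagram of a partition $\lambda$, its arm is the number of boxes strictly to its right in its row and its leg the number of boxes strictly below it in its column; let $\mathcal A_\lambda$ and $\mathcal L_\lambda$ be the sets of arms and legs of $\lambda$. The characteristic vector $(c_0,c_1,c_2)\in\mathbb Z^3$ of a $3$-core $\lambda$ is defined as follows: for $i\in\{0,1,2\}$, if no element of $\mathcal L_\lambda$ is congruent to $2-i$ modulo $3$, then $c_i$ is the number of elements of $\mathcal A_\lambda$ congruent to $i$ modulo $3$; otherwise $-c_i$ is the number of elements of $\mathcal L_\lambda$ congruent to $2-i$ modulo $3$. Let $\mathcal C_n$ be the set of characteristic vectors of the $3$-core partitions of $n$, where $(x,y)\in\mathbb Z^2$ is identified with the vector $(-x-y,x,y)$. 1. For all integers $n\ge 1$ and $k\ge 0$, $$a_3\bigl(3n^2+(3^{k+1}+2)n+3^k\bigr)=a_3(n)\,a_3(n+3^k).$$ 2. For all integers $n\ge 1$ and $k\ge 0$, with $N=3n^2+(3^{k+1}+2)n+3^k$, the map $$((x,y),(x',y'))\longmapsto\bigl(x+x'+3xx'+3xy'+3yx',\;y+y'-3xx'+3yy'\bigr)$$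 is a well-defined bijection from $\mathcal C_n\times\mathcal C_{n+3^k}$ onto $\mathcal C_N$. 3. For all integers $n,m\ge 0$ such that $3n+1$ and $3m+1$ are coprime, $$a_3(3mn+m+n)=a_3(n)\,a_3(m).$$ -/

import Mathlib

namespace ThreeCore

/-- The number of boxes in the same row as `c` and strictly to the right of `c`
(used for boxes `c` of `μ`; rows and columns are numbered from `0`). -/
def armLength (μ : YoungDiagram) (c : ℕ × ℕ) : ℕ := μ.rowLen c.1 - (c.2 + 1)

/-- The number of boxes in the same column as `c` and strictly below `c`
(used for boxes `c` of `μ`). -/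
def legLength (μ : YoungDiagram) (c : ℕ × ℕ) : ℕ := μ.colLen c.2 - (c.1 + 1)

/-- The number of boxes in the hook of `c`: the box `c` itself, the boxes to its right and
the boxes below it. -/
def hookLength (μ : YoungDiagram) (c : ℕ × ℕ) : ℕ := armLength μ c + legLength μ c + 1

/-- A partition (seen as its Young diagram) is a `3`-core if it has no hook of length `3`. -/
def IsThreeCore (μ : YoungDiagram) : Prop := ∀ c ∈ μ, hookLength μ c ≠ 3

/-- The set of `3`-core partitions of `n`. -/
def cores (n : ℕ) : Set YoungDiagram := {μ | IsThreeCore μ ∧ μ.card = n}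

/-- The number of `3`-core partitions of `n` (a finite number, see `cores_finite`). -/
noncomputable def a₃ (n : ℕ) : ℕ := (cores n).ncard

/-- The diagonal boxes of a Young diagram. -/
def diagonal (μ : YoungDiagram) : Finset (ℕ × ℕ) := μ.cells.filter fun c => c.1 = c.2

/-- The set of arms of a partition: the arm lengths of its diagonal boxes. -/
def arms (μ : YoungDiagram) : Finset ℕ := (diagonal μ).image (armLength μ)

/-- The set of legs of a partition: the leg lengths of its diagonal boxes. -/
def legs (μ : YoungDiagram) : Finset ℕ := (diagonal μ).image (legLength μ)

/-- The black beads over the fence on runner `i` of the pointed `3`-abacus of `μ`: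
the arm `3 * q + i` stands for the black bead at position `q`. -/
def blackBeads (μ : YoungDiagram) (i : Fin 3) : Finset ℕ :=
  (arms μ).filter fun a => a % 3 = (i : ℕ)

/-- The white beads under the fence on runner `i` of the pointed `3`-abacus of `μ`:
the leg `3 * q + r`, with `r = 2 - i`, stands for the white bead at position `q`. -/
def whiteBeads (μ : YoungDiagram) (i : Fin 3) : Finset ℕ :=
  (legs μ).filter fun l => l % 3 + (i : ℕ) = 2

/-- The characteristic vector `(c₀, c₁, c₂)` of a `3`-core partition `μ`: `cᵢ` is the number of
black beads over the fence on runner `i` if that runner has no white bead under the fence, and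
otherwise `-cᵢ` is the number of white beads under the fence on runner `i`. -/
def charVec (μ : YoungDiagram) (i : Fin 3) : ℤ :=
  if whiteBeads μ i = ∅ then ((blackBeads μ i).card : ℤ) else -((whiteBeads μ i).card : ℤ)

/-- The set `𝒞ₙ` of characteristic vectors of the `3`-core partitions of `n`, where
`(x, y) ∈ ℤ²` is identified with the vector `(-x - y, x, y)`. -/
def C (n : ℕ) : Set (ℤ × ℤ) :=
  {p | ∃ μ ∈ cores n, charVec μ = ![-p.1 - p.2, p.1, p.2]}

/-- The map `((x, y), (x', y')) ↦ (x + x' + 3xx' + 3xy' + 3yx', y + y' - 3xx' + 3yy')`. -/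
def alpha (q : (ℤ × ℤ) × (ℤ × ℤ)) : ℤ × ℤ :=
  (q.1.1 + q.2.1 + 3 * q.1.1 * q.2.1 + 3 * q.1.1 * q.2.2 + 3 * q.1.2 * q.2.1,
    q.1.2 + q.2.2 - 3 * q.1.1 * q.2.1 + 3 * q.1.2 * q.2.2)

theorem cores_finite (n : ℕ) : (cores n).Finite := by
  have h : Set.InjOn YoungDiagram.cells (cores n) := fun μ _ ν _ e => YoungDiagram.ext e
  refine Set.Finite.of_finite_image (Set.Finite.subset
    (Finset.finite_toSet (Finset.range n ×ˢ Finset.range n).powerset) ?_) h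
  rintro _ ⟨μ, ⟨-, hμ⟩, rfl⟩
  simp only [Finset.coe_powerset, Set.mem_preimage, Set.mem_powerset_iff, Finset.coe_subset]
  rintro ⟨i, j⟩ hc
  have h1 : μ.rowLen i ≤ n := by
    rw [YoungDiagram.rowLen_eq_card, ← hμ]; exact Finset.card_le_card (Finset.filter_subset _ _)
  have h2 : μ.colLen j ≤ n := by
    rw [YoungDiagram.colLen_eq_card, ← hμ]; exact Finset.card_le_card (Finset.filter_subset _ _)
  have h3 := YoungDiagram.mem_iff_lt_rowLen.1 ((YoungDiagram.mem_cells _).1 hc)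
  have h4 := YoungDiagram.mem_iff_lt_colLen.1 ((YoungDiagram.mem_cells _).1 hc)
  simp only [Finset.mem_product, Finset.mem_range]
  omega

end ThreeCore

/-!
The bead set of a partition, `{rowLen i - i - 1 : i ∈ ℕ} ⊆ ℤ`, has complement
`{j - colLen j : j ∈ ℕ}`, and the hook of a box `(i, j)` has length equal to the difference of the
corresponding bead and gap. Hence a partition is a `3`-core exactly when its bead set is stable
under subtracting `3` (`isThreeCore_iff`), that is, when on each of the three residue classes the
beads are the positions below some threshold. Arms are the nonnegative beads and legs the negative
gaps, so the thresholds are the entries of the characteristic vector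
(`IsThreeCore.mem_beads_iff`). They have sum `0`, any integer vector with sum `0` occurs
(`exists_isThreeCore_charVec`), and the vector determines the `3`-core. Summing arms and legs,
the size of the `3`-core with vector `(-x - y, x, y)` is `3 (x² + xy + y²) + x + 2y`
(`IsThreeCore.card_eq_coreSize`).

Now send `(x, y)` to the Eisenstein integer `z = 1 + 3 (y - x ω)`. Its norm is `3 n + 1`, where
`n` is the size, and every element congruent to `1` modulo `3` arises once. So `C n` is the set of
`z ≡ 1 (mod 3)` of norm `3 n + 1`, and `alpha` is multiplication (`toEisenstein_alpha`). When
`3 n + 1` and `3 m + 1` are coprime, multiplication is a bijection from pairs of such elements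
onto the elements of norm `(3 n + 1) (3 m + 1)`: the Eisenstein integers form a principal ideal
domain, the factors are recovered as greatest common divisors with `3 n + 1` and `3 m + 1`, and
every element whose norm is `1` modulo `3` has an associate that is `1` modulo `3` (`bijOn_alpha`).
All three claims are instances of this, since `3 n + 1` and `3 (n + 3 ^ k) + 1` differ by a power
of `3` and neither is divisible by `3`.
-/

namespace ThreeCore

/-! ### Arithmetic of the Eisenstein integers -/

/-- The ring `ℤ[ω]` of Eisenstein integers, where `ω ^ 2 = -1 - ω`. -/
abbrev Eisenstein : Type := QuadraticAlgebra ℤ (-1) (-1)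

namespace Eisenstein

open QuadraticAlgebra

theorem norm_eq (z : Eisenstein) : norm z = z.re ^ 2 - z.re * z.im + z.im ^ 2 := by
  rw [norm_def]; ring

theorem norm_nonneg (z : Eisenstein) : 0 ≤ norm z := by
  rw [norm_eq]; nlinarith [sq_nonneg (z.re - z.im), sq_nonneg z.re, sq_nonneg z.im]

theorem norm_eq_zero {z : Eisenstein} : norm z = 0 ↔ z = 0 := by
  refine ⟨fun h => ?_, fun h => by rw [h, QuadraticAlgebra.norm_zero]⟩
  rw [norm_eq] at h
  have h1 : z.re = 0 := by nlinarith [sq_nonneg (z.re - 2 * z.im), sq_nonneg z.re]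
  have h2 : z.im = 0 := by nlinarith [sq_nonneg (z.im - 2 * z.re), sq_nonneg z.im]
  exact QuadraticAlgebra.ext h1 h2

instance : NoZeroDivisors Eisenstein where
  eq_zero_or_eq_zero_of_mul_eq_zero {a b} h := by
    simpa only [map_mul, QuadraticAlgebra.norm_zero, mul_eq_zero, norm_eq_zero]
      using congrArg QuadraticAlgebra.norm h

theorem intCast_norm (z : Eisenstein) : ((norm z : ℤ) : Eisenstein) = z * star z :=
  algebraMap_norm_eq_mul_star z

theorem intCast_dvd_intCast {m n : ℤ} : (m : Eisenstein) ∣ (n : Eisenstein) ↔ m ∣ n :=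
  algebraMap_dvd_iff_dvd

theorem exists_abs_sub_mul_le (p : ℤ) {n : ℤ} (hn : 0 < n) : ∃ q : ℤ, 2 * |p - n * q| ≤ n := by
  refine ⟨(2 * p + n) / (2 * n), ?_⟩
  have h1 := Int.emod_add_mul_ediv (2 * p + n) (2 * n)
  have h2 := Int.emod_nonneg (2 * p + n) (by lia : 2 * n ≠ 0)
  have h3 := Int.emod_lt_of_pos (2 * p + n) (by lia : 0 < 2 * n)
  rcases abs_cases (p - n * ((2 * p + n) / (2 * n))) with ⟨h, -⟩ | ⟨h, -⟩ <;> rw [h] <;> lia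

/-- Division with remainder for the norm: round both coordinates of `x / y`. -/
theorem exists_norm_sub_mul_lt (x : Eisenstein) {y : Eisenstein} (hy : y ≠ 0) :
    ∃ q, norm (x - y * q) < norm y := by
  have hn : 0 < norm y := (norm_nonneg y).lt_of_ne fun h => hy (norm_eq_zero.1 h.symm)
  obtain ⟨q₁, h₁⟩ := exists_abs_sub_mul_le (x * star y).re hn
  obtain ⟨q₂, h₂⟩ := exists_abs_sub_mul_le (x * star y).im hn
  refine ⟨⟨q₁, q₂⟩, ?_⟩
  set n := norm y with hdef
  set r := (x * star y).re - n * q₁ with hr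
  set s := (x * star y).im - n * q₂ with hs
  have key : norm (x - y * ⟨q₁, q₂⟩) * n = r ^ 2 - r * s + s ^ 2 := by
    rw [hdef, ← QuadraticAlgebra.norm_star y, ← map_mul]
    have e : (x - y * ⟨q₁, q₂⟩) * star y = ⟨r, s⟩ := by
      have : (x - y * ⟨q₁, q₂⟩) * star y = x * star y - ((n : ℤ) : Eisenstein) * ⟨q₁, q₂⟩ := by
        rw [intCast_norm]; ring
      rw [this]
      ext <;> simp [hr, hs]
    rw [e, norm_eq]
  have b₁ : |r| * |r| ≤ |r| * n := by nlinarith [abs_nonneg r]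
  have : 4 * (r ^ 2 - r * s + s ^ 2) ≤ 3 * n ^ 2 := by
    have h3 : -(r * s) ≤ |r| * |s| := by rw [← abs_mul]; exact neg_le_abs _
    rw [← sq_abs r, ← sq_abs s]
    nlinarith [abs_nonneg r, abs_nonneg s]
  nlinarith

instance : IsPrincipalIdealRing Eisenstein where
  principal I := by
    by_cases hI : ∃ g ∈ I, g ≠ 0
    · -- A nonzero element of least norm generates `I`.
      obtain ⟨g, ⟨hg, hg0⟩, hmin⟩ := WellFounded.has_min
        (InvImage.wf (fun z : Eisenstein => (norm z).natAbs) Nat.lt_wfRel.wf)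
        {g : Eisenstein | g ∈ I ∧ g ≠ 0} hI
      refine ⟨g, le_antisymm (fun x hx => ?_) ((Ideal.span_singleton_le_iff_mem I).2 hg)⟩
      obtain ⟨q, hq⟩ := exists_norm_sub_mul_lt x hg0
      have hmem : x - g * q ∈ I := I.sub_mem hx (I.mul_mem_right _ hg)
      have h0 : x - g * q = 0 := by
        by_contra h
        exact hmin _ ⟨hmem, h⟩ (Int.natAbs_lt_natAbs_of_nonneg_of_lt (norm_nonneg _) hq)
      exact Ideal.mem_span_singleton.2 ⟨q, sub_eq_zero.1 h0⟩
    · push Not at hI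
      exact ⟨0, by simpa using (Submodule.eq_bot_iff I).2 hI⟩

/-- An Eisenstein integer whose norm is a product of two coprime positive integers splits
accordingly: the first factor is its greatest common divisor with the first integer. -/
theorem exists_mul_eq_of_norm_eq_mul {u : Eisenstein} {A B : ℤ} (hA : 0 < A) (h : IsCoprime A B)
    (hu : norm u = A * B) : ∃ d e, d * e = u ∧ norm d = A ∧ norm e = B := by
  obtain ⟨d, hd⟩ := (IsPrincipalIdealRing.principal (Ideal.span {u, (A : Eisenstein)})).principal
  obtain ⟨e, he⟩ : d ∣ u := Ideal.mem_span_singleton.1 <| by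
    rw [Ideal.span, ← hd]; exact Ideal.subset_span (by simp)
  obtain ⟨f, hf⟩ : d ∣ (A : Eisenstein) := Ideal.mem_span_singleton.1 <| by
    rw [Ideal.span, ← hd]; exact Ideal.subset_span (by simp)
  obtain ⟨s, t, hst⟩ : ∃ s t, s * u + t * (A : Eisenstein) = d := Ideal.mem_span_pair.1 <| by
    rw [hd]; exact Ideal.mem_span_singleton_self d
  have h1 : A ∣ norm d := by
    rw [← intCast_dvd_intCast, intCast_norm, ← hst, star_add, star_mul, star_mul,
      (star_intCast A : star (A : Eisenstein) = A)]
    have huu : u * star u = (A : Eisenstein) * B := by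
      rw [← intCast_norm, hu]; push_cast; rfl
    exact ⟨B * s * star s + s * u * star t + t * star u * star s + t * A * star t, by
      linear_combination s * star s * huu⟩
  have h2 : norm d ∣ A := by
    obtain ⟨x, y, hxy⟩ := h
    have e1 : A * B = norm d * norm e := by rw [← hu, he, map_mul]
    have e2 : A ^ 2 = norm d * norm f := by rw [← map_mul, ← hf, norm_intCast, Int.cast_id]
    exact ⟨x * norm f + y * norm e, by linear_combination -A * hxy + x * e2 + y * e1⟩
  have hdA : norm d = A := Int.dvd_antisymm (norm_nonneg d) hA.le h2 h1
  refine ⟨d, e, he.symm, hdA, ?_⟩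
  rw [he, map_mul, hdA] at hu
  exact mul_left_cancel₀ hA.ne' hu

/-- Elements with coprime norms are coprime. -/
theorem isCoprime_of_norm {z w : Eisenstein} (h : IsCoprime (norm z) (norm w)) :
    IsCoprime z w := by
  have h' : IsCoprime ((norm z : ℤ) : Eisenstein) ((norm w : ℤ) : Eisenstein) :=
    h.map (Int.castRingHom Eisenstein)
  rw [intCast_norm, intCast_norm] at h'
  exact h'.of_mul_left_left.of_mul_right_left

/-- An Eisenstein integer of norm congruent to `1` modulo `3` has an associate congruent to `1`
modulo `3`. -/
theorem exists_associate {z : Eisenstein} (h : norm z % 3 = 1) :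
    ∃ ε ε' : Eisenstein, ε * ε' = 1 ∧ (ε * z).re % 3 = 1 ∧ (ε * z).im % 3 = 0 := by
  obtain ⟨a, b⟩ := z
  have hmod : (a + b) % 3 = 1 ∨ (a + b) % 3 = 2 := by
    rw [norm_eq] at h
    have h3 : ((a + b) * (a + b)) % 3 = 1 := by
      have : (a + b) * (a + b) = (a ^ 2 - a * b + b ^ 2) + 3 * (a * b) := by ring
      rw [this, Int.add_mul_emod_self_left]; exact h
    have : (a + b) % 3 = 0 ∨ (a + b) % 3 = 1 ∨ (a + b) % 3 = 2 := by lia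
    rcases this with h' | h' | h' <;> simp [Int.mul_emod, h'] at h3 ⊢
  -- `ε` is one of the six units `±1`, `±ω`, `±ω ^ 2`, found from the residues of `a` and `b`.
  have unit (ε ε' : Eisenstein) (h : ε * ε' = 1)
      (h' : (ε * ⟨a, b⟩).re % 3 = 1 ∧ (ε * ⟨a, b⟩).im % 3 = 0) :
      ∃ ε ε' : Eisenstein, ε * ε' = 1 ∧ (ε * ⟨a, b⟩).re % 3 = 1 ∧ (ε * ⟨a, b⟩).im % 3 = 0 :=
    ⟨ε, ε', h, h'⟩
  have cases : (a % 3 = 1 ∧ b % 3 = 0) ∨ (a % 3 = 2 ∧ b % 3 = 0) ∨ (a % 3 = 0 ∧ b % 3 = 1) ∨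
      (a % 3 = 0 ∧ b % 3 = 2) ∨ (a % 3 = 1 ∧ b % 3 = 1) ∨ (a % 3 = 2 ∧ b % 3 = 2) := by lia
  rcases cases with c | c | c | c | c | c
  · exact unit 1 1 (by ext <;> simp) (by simp; lia)
  · exact unit (-1) (-1) (by ext <;> simp) (by simp; lia)
  · exact unit ⟨-1, -1⟩ ⟨0, 1⟩ (by ext <;> simp) (by simp; lia)
  · exact unit ⟨1, 1⟩ ⟨0, -1⟩ (by ext <;> simp) (by simp; lia)
  · exact unit ⟨0, -1⟩ ⟨1, 1⟩ (by ext <;> simp) (by simp; lia)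
  · exact unit ⟨0, 1⟩ ⟨-1, -1⟩ (by ext <;> simp) (by simp; lia)

end Eisenstein

/-! ### The map `alpha` as multiplication of Eisenstein integers -/

/-- The number of boxes of the `3`-core with characteristic vector `(-x - y, x, y)`. -/
def coreSize (p : ℤ × ℤ) : ℤ := 3 * (p.1 ^ 2 + p.1 * p.2 + p.2 ^ 2) + p.1 + 2 * p.2

/-- The Eisenstein integer `1 + 3 (y - x ω)` attached to `(x, y)`. -/
def toEisenstein (p : ℤ × ℤ) : Eisenstein := ⟨1 + 3 * p.2, -3 * p.1⟩

open QuadraticAlgebra Eisenstein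

theorem norm_toEisenstein (p : ℤ × ℤ) : norm (toEisenstein p) = 3 * coreSize p + 1 := by
  simp only [norm_eq, toEisenstein, coreSize]; ring

theorem toEisenstein_alpha (q : (ℤ × ℤ) × (ℤ × ℤ)) :
    toEisenstein (alpha q) = toEisenstein q.1 * toEisenstein q.2 := by
  ext <;> simp [toEisenstein, alpha] <;> ring

theorem toEisenstein_injective : Function.Injective toEisenstein := by
  rintro ⟨x, y⟩ ⟨x', y'⟩ h
  simp only [toEisenstein, QuadraticAlgebra.mk.injEq] at h
  ext <;> simp <;> lia

/-- The image of `toEisenstein` consists of the elements congruent to `1` modulo `3`. -/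
theorem exists_toEisenstein_eq {z : Eisenstein} (h₁ : z.re % 3 = 1) (h₂ : z.im % 3 = 0) :
    ∃ p, toEisenstein p = z :=
  ⟨(-(z.im / 3), z.re / 3), by ext <;> simp [toEisenstein] <;> lia⟩

theorem coreSize_alpha (q : (ℤ × ℤ) × (ℤ × ℤ)) :
    3 * coreSize (alpha q) + 1 = (3 * coreSize q.1 + 1) * (3 * coreSize q.2 + 1) := by
  simp only [← norm_toEisenstein, toEisenstein_alpha, map_mul]

/-- Two elements congruent to `1` modulo `3` of the same norm, one dividing the other, are
equal: their quotient is a unit congruent to `1` modulo `3`. -/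
theorem eq_of_toEisenstein_dvd {p p' : ℤ × ℤ} (h : coreSize p = coreSize p')
    (hdvd : toEisenstein p ∣ toEisenstein p') : p = p' := by
  obtain ⟨u, hu⟩ := hdvd
  have hN := norm_toEisenstein p
  have h1 : norm u = 1 := by
    have h2 := congrArg QuadraticAlgebra.norm hu
    rw [map_mul, norm_toEisenstein, hN, ← h] at h2
    have : 3 * coreSize p + 1 ≠ 0 := by lia
    exact mul_left_cancel₀ this (by rw [← h2, mul_one])
  have hre := congrArg QuadraticAlgebra.re hu
  have him := congrArg QuadraticAlgebra.im hu
  simp [toEisenstein] at hre him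
  obtain ⟨v, hv⟩ : ∃ v, toEisenstein v = u := by
    obtain ⟨a, b⟩ := u
    simp only at hre him
    apply exists_toEisenstein_eq <;> simp only
    · have : a = 1 + 3 * (p'.2 - p.2 * a - p.1 * b) := by linear_combination -hre
      lia
    · have : b = 3 * (p.1 * a - p'.1 - p.2 * b - p.1 * b) := by linear_combination -him
      lia
  have hv0 : coreSize v = 0 := by
    have := norm_toEisenstein v
    rw [hv, h1] at this; lia
  have hx : v.1 = 0 ∧ v.2 = 0 := by
    obtain ⟨x, y⟩ := v
    simp only [coreSize] at hv0 ⊢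
    constructor
    · nlinarith [sq_nonneg (x + 2 * y), sq_nonneg (x + 2 * y + 1), sq_nonneg x]
    · nlinarith [sq_nonneg (x + 2 * y), sq_nonneg (x + 2 * y + 1), sq_nonneg x]
  have hu1 : u = 1 := by
    rw [← hv]; ext <;> simp [toEisenstein, hx]
  rw [hu1, mul_one] at hu
  exact toEisenstein_injective hu.symm

theorem bijOn_alpha {n m : ℕ} (h : Nat.Coprime (3 * n + 1) (3 * m + 1)) :
    Set.BijOn alpha ({p | coreSize p = n} ×ˢ {p | coreSize p = m})
      {p | coreSize p = (3 * m * n + m + n : ℕ)} := by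
  have hco : IsCoprime (3 * n + 1 : ℤ) (3 * m + 1) := by
    simpa using Nat.isCoprime_iff_coprime.2 h
  refine ⟨?_, ?_, ?_⟩
  · rintro q ⟨h₁, h₂⟩
    simp only [Set.mem_ofPred_eq] at h₁ h₂ ⊢
    have := coreSize_alpha q
    rw [h₁, h₂] at this
    push_cast; linarith
  · rintro ⟨p, q⟩ ⟨h₁, h₂⟩ ⟨p', q'⟩ ⟨h₁', h₂'⟩ he
    simp only [Set.mem_ofPred_eq] at h₁ h₂ h₁' h₂'
    have he' := congrArg toEisenstein he
    simp only [toEisenstein_alpha] at he'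
    have hcop : IsCoprime (toEisenstein p) (toEisenstein q') := by
      apply isCoprime_of_norm
      rwa [norm_toEisenstein, norm_toEisenstein, h₁, h₂']
    have hpp : p = p' := eq_of_toEisenstein_dvd (by rw [h₁, h₁'])
      (hcop.dvd_of_dvd_mul_right ⟨_, he'.symm⟩)
    subst hpp
    have hp0 : toEisenstein p ≠ 0 := by
      rw [ne_eq, ← norm_eq_zero, norm_toEisenstein]; lia
    rw [toEisenstein_injective (mul_left_cancel₀ hp0 he')]
  · intro p hp
    simp only [Set.mem_ofPred_eq] at hp
    obtain ⟨d, e, hde, hd, he⟩ := exists_mul_eq_of_norm_eq_mul (u := toEisenstein p)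
      (by positivity) hco (by rw [norm_toEisenstein, hp]; push_cast; ring)
    obtain ⟨ε, ε', hε, hr, hi⟩ := exists_associate (z := d) (by rw [hd]; lia)
    obtain ⟨a, ha⟩ := exists_toEisenstein_eq hr hi
    have hprod : (ε * d) * (ε' * e) = toEisenstein p := by
      rw [← hde]; linear_combination d * e * hε
    obtain ⟨b, hb⟩ : ∃ b, toEisenstein b = ε' * e := by
      have hre := congrArg QuadraticAlgebra.re hprod
      have him := congrArg QuadraticAlgebra.im hprod
      rw [← ha] at hre him
      generalize ε' * e = w at hre him
      obtain ⟨x, y⟩ := w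
      simp [toEisenstein] at hre him
      apply exists_toEisenstein_eq <;> simp only
      · have : x = 1 + 3 * (p.2 - a.2 * x - a.1 * y) := by linear_combination hre
        lia
      · have : y = 3 * (a.1 * x - p.1 - a.2 * y - a.1 * y) := by linear_combination him
        lia
    have hmul : norm ε * norm ε' = 1 := by rw [← map_mul, hε, QuadraticAlgebra.norm_one]
    have hunit : norm ε = 1 := Int.eq_one_of_mul_eq_one_right (norm_nonneg ε) hmul
    have hunit' : norm ε' = 1 := by rwa [hunit, one_mul] at hmul
    refine ⟨(a, b), ⟨?_, ?_⟩, toEisenstein_injective ?_⟩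
    · have := norm_toEisenstein a
      rw [ha, map_mul, hunit, hd] at this
      simp only [Set.mem_ofPred_eq]; lia
    · have := norm_toEisenstein b
      rw [hb, map_mul, hunit', he] at this
      simp only [Set.mem_ofPred_eq]; lia
    · rw [toEisenstein_alpha, ha, hb, hprod]

/-! ### The bead set of a partition -/

/-- The bead (element of the beta-set, normalised to charge `0`) of the `i`-th row. -/
def rowPos (μ : YoungDiagram) (i : ℕ) : ℤ := μ.rowLen i - i - 1

/-- The gap of the bead set that belongs to the `j`-th column. -/
def colPos (μ : YoungDiagram) (j : ℕ) : ℤ := j - μ.colLen j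

/-- The bead set of a partition; it contains all sufficiently small integers. -/
def beads (μ : YoungDiagram) : Set ℤ := Set.range (rowPos μ)

theorem mem_diagram_iff {μ : YoungDiagram} {i j : ℕ} : (i, j) ∈ μ ↔ colPos μ j < rowPos μ i := by
  have h1 := YoungDiagram.mem_iff_lt_rowLen (μ := μ) (i := i) (j := j)
  have h2 := YoungDiagram.mem_iff_lt_colLen (μ := μ) (i := i) (j := j)
  by_cases h : (i, j) ∈ μ <;> simp only [h, true_iff, false_iff, colPos, rowPos] at h1 h2 ⊢ <;> lia

theorem hookLength_eq {μ : YoungDiagram} {i j : ℕ} (h : (i, j) ∈ μ) :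
    (hookLength μ (i, j) : ℤ) = rowPos μ i - colPos μ j := by
  have h1 := YoungDiagram.mem_iff_lt_rowLen.1 h
  have h2 := YoungDiagram.mem_iff_lt_colLen.1 h
  simp only [hookLength, armLength, legLength, rowPos, colPos]
  lia

theorem rowPos_strictAnti (μ : YoungDiagram) : StrictAnti (rowPos μ) := fun i j h => by
  have := μ.rowLen_anti i j h.le
  simp only [rowPos]; lia

theorem rowPos_ne_colPos (μ : YoungDiagram) (i j : ℕ) : rowPos μ i ≠ colPos μ j := by
  have h1 := YoungDiagram.mem_iff_lt_rowLen (μ := μ) (i := i) (j := j)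
  have h2 := YoungDiagram.mem_iff_lt_colLen (μ := μ) (i := i) (j := j)
  by_cases h : (i, j) ∈ μ <;> simp only [h, true_iff, false_iff, colPos, rowPos] at h1 h2 ⊢ <;> lia

theorem rowLen_eq_zero {μ : YoungDiagram} {i : ℕ} (h : μ.colLen 0 ≤ i) : μ.rowLen i = 0 := by
  by_contra h0
  exact absurd (YoungDiagram.mem_iff_lt_colLen.1
    (YoungDiagram.mem_iff_lt_rowLen.2 (Nat.pos_of_ne_zero h0))) (by lia)

theorem colLen_eq_of_mem {μ : YoungDiagram} {i j : ℕ} (h : (i, j) ∉ μ)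
    (h' : ∀ i', i = i' + 1 → (i', j) ∈ μ) : μ.colLen j = i := by
  rw [YoungDiagram.mem_iff_lt_colLen] at h
  rcases i with - | i'
  · lia
  · have := YoungDiagram.mem_iff_lt_colLen.1 (h' i' rfl); lia

/-- The integers that are not beads are exactly the gaps of the columns. -/
theorem notMem_beads_iff {μ : YoungDiagram} {t : ℤ} : t ∉ beads μ ↔ t ∈ Set.range (colPos μ) := by
  constructor
  · intro ht
    have hex : ∃ i, rowPos μ i ≤ t := by
      refine ⟨μ.colLen 0 + (-t).toNat, ?_⟩
      have := rowLen_eq_zero (μ := μ) (i := μ.colLen 0 + (-t).toNat) (by lia)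
      simp only [rowPos]; lia
    classical
    -- The first row whose bead lies below `t` cuts out the column with gap `t`.
    set i := Nat.find hex with hi
    have h1 : rowPos μ i ≤ t := Nat.find_spec hex
    have h2 : rowPos μ i ≠ t := fun h => ht ⟨i, h⟩
    simp only [rowPos] at h1 h2
    have hcol : μ.colLen (t + i).toNat = i := by
      apply colLen_eq_of_mem
      · rw [YoungDiagram.mem_iff_lt_rowLen]; lia
      · intro i' h'
        have h3 : ¬ rowPos μ i' ≤ t := Nat.find_min hex (by lia)
        rw [YoungDiagram.mem_iff_lt_rowLen]
        simp only [rowPos] at h3; lia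
    exact ⟨(t + i).toNat, by simp only [colPos]; lia⟩
  · rintro ⟨j, rfl⟩ ⟨i, hi⟩
    exact rowPos_ne_colPos μ i j hi

theorem eq_of_beads_eq {μ ν : YoungDiagram} (h : beads μ = beads ν) : μ = ν := by
  have h1 : rowPos μ = rowPos ν := by
    have hneg : Set.range (fun i => -rowPos μ i) = Set.range (fun i => -rowPos ν i) := by
      have := congrArg (fun s => (fun t : ℤ => -t) '' s) h
      simpa only [beads, ← Set.range_comp, Function.comp_def] using this
    have := ((rowPos_strictAnti μ).neg.range_inj (rowPos_strictAnti ν).neg).1 hneg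
    exact neg_injective this
  ext ⟨i, j⟩
  have := congrFun h1 i
  simp only [rowPos] at this
  rw [YoungDiagram.mem_cells, YoungDiagram.mem_cells, YoungDiagram.mem_iff_lt_rowLen,
    YoungDiagram.mem_iff_lt_rowLen]
  lia

/-- A hook of length `3` is a bead with a gap `3` places below it. -/
theorem isThreeCore_iff {μ : YoungDiagram} : IsThreeCore μ ↔ ∀ t ∈ beads μ, t - 3 ∈ beads μ := by
  constructor
  · rintro h _ ⟨i, rfl⟩
    by_contra hn
    obtain ⟨j, hj⟩ := notMem_beads_iff.1 hn
    have hij : (i, j) ∈ μ := mem_diagram_iff.2 (by lia)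
    exact h _ hij (by have := hookLength_eq hij; lia)
  · rintro h ⟨i, j⟩ hij h3
    have := hookLength_eq hij
    refine notMem_beads_iff.2 ⟨j, ?_⟩ (h _ ⟨i, rfl⟩)
    lia

theorem mem_diagonal {μ : YoungDiagram} {c : ℕ × ℕ} : c ∈ diagonal μ ↔ c ∈ μ ∧ c.1 = c.2 := by
  simp [diagonal]

theorem armLength_diagonal {μ : YoungDiagram} {d : ℕ} (h : (d, d) ∈ μ) :
    (armLength μ (d, d) : ℤ) = rowPos μ d := by
  have := YoungDiagram.mem_iff_lt_rowLen.1 h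
  simp only [armLength, rowPos]; lia

theorem legLength_diagonal {μ : YoungDiagram} {d : ℕ} (h : (d, d) ∈ μ) :
    (legLength μ (d, d) : ℤ) = -1 - colPos μ d := by
  have := YoungDiagram.mem_iff_lt_colLen.1 h
  simp only [legLength, colPos]; lia

/-- The arms are the nonnegative beads. -/
theorem mem_arms {μ : YoungDiagram} {a : ℕ} : a ∈ arms μ ↔ (a : ℤ) ∈ beads μ := by
  simp only [arms, Finset.mem_image, mem_diagonal]
  constructor
  · rintro ⟨⟨d, d'⟩, ⟨hd, h : d = d'⟩, rfl⟩
    subst h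
    exact ⟨d, (armLength_diagonal hd).symm⟩
  · rintro ⟨d, hd⟩
    have hdd : (d, d) ∈ μ := by
      rw [YoungDiagram.mem_iff_lt_rowLen]; simp only [rowPos] at hd; lia
    exact ⟨(d, d), ⟨hdd, rfl⟩, by have := armLength_diagonal hdd; lia⟩

/-- The legs `l` stand for the negative gaps `-1 - l`. -/
theorem mem_legs {μ : YoungDiagram} {l : ℕ} : l ∈ legs μ ↔ (-1 - l : ℤ) ∉ beads μ := by
  rw [notMem_beads_iff]
  simp only [legs, Finset.mem_image, mem_diagonal]
  constructor
  · rintro ⟨⟨d, d'⟩, ⟨hd, h : d = d'⟩, rfl⟩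
    subst h
    exact ⟨d, by have := legLength_diagonal hd; lia⟩
  · rintro ⟨d, hd⟩
    have hdd : (d, d) ∈ μ := by
      rw [YoungDiagram.mem_iff_lt_colLen]; simp only [colPos] at hd; lia
    exact ⟨(d, d), ⟨hdd, rfl⟩, by have := legLength_diagonal hdd; lia⟩

/-! ### Frobenius coordinates and the size of a partition -/

theorem armLength_injOn (μ : YoungDiagram) : Set.InjOn (armLength μ) (diagonal μ) := by
  rintro ⟨d, d'⟩ h ⟨e, e'⟩ h' he
  obtain ⟨h1, rfl : d = d'⟩ := mem_diagonal.1 h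
  obtain ⟨h2, rfl : e = e'⟩ := mem_diagonal.1 h'
  have : rowPos μ d = rowPos μ e := by rw [← armLength_diagonal h1, ← armLength_diagonal h2, he]
  rw [(rowPos_strictAnti μ).injective this]

theorem legLength_injOn (μ : YoungDiagram) : Set.InjOn (legLength μ) (diagonal μ) := by
  rintro ⟨d, d'⟩ h ⟨e, e'⟩ h' he
  obtain ⟨h1, rfl : d = d'⟩ := mem_diagonal.1 h
  obtain ⟨h2, rfl : e = e'⟩ := mem_diagonal.1 h'
  have hl : colPos μ d = colPos μ e := by
    have := legLength_diagonal h1; have := legLength_diagonal h2; lia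
  simp only [colPos] at hl
  rcases le_total d e with hde | hde <;> have := μ.colLen_anti _ _ hde <;> simp <;> lia

theorem card_arms_eq_card_legs (μ : YoungDiagram) : (arms μ).card = (legs μ).card := by
  rw [arms, legs, Finset.card_image_of_injOn (armLength_injOn μ),
    Finset.card_image_of_injOn (legLength_injOn μ)]

/-- The boxes whose smaller coordinate is `d` form the hook of the diagonal box `(d, d)`. -/
theorem card_principal_hook {μ : YoungDiagram} {d : ℕ} (h : (d, d) ∈ μ) :
    (μ.cells.filter fun c => min c.1 c.2 = d).card =
      armLength μ (d, d) + (legLength μ (d, d) + 1) := by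
  have h1 := YoungDiagram.mem_iff_lt_rowLen.1 h
  have h2 := YoungDiagram.mem_iff_lt_colLen.1 h
  have : (μ.cells.filter fun c => min c.1 c.2 = d) =
      (Finset.Ico d (μ.rowLen d)).image (fun j => (d, j)) ∪
        (Finset.Ico (d + 1) (μ.colLen d)).image (fun i => (i, d)) := by
    ext ⟨i, j⟩
    simp only [Finset.mem_filter, YoungDiagram.mem_cells, Finset.mem_union, Finset.mem_image,
      Finset.mem_Ico, Prod.mk.injEq]
    constructor
    · rintro ⟨hm, hmin⟩
      rcases le_or_gt i j with hij | hij
      · obtain rfl : i = d := by lia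
        exact Or.inl ⟨j, ⟨hij, YoungDiagram.mem_iff_lt_rowLen.1 hm⟩, rfl, rfl⟩
      · obtain rfl : j = d := by lia
        exact Or.inr ⟨i, ⟨hij, YoungDiagram.mem_iff_lt_colLen.1 hm⟩, rfl, rfl⟩
    · rintro (⟨j', ⟨hj, hj'⟩, rfl, rfl⟩ | ⟨i', ⟨hi, hi'⟩, rfl, rfl⟩)
      · exact ⟨YoungDiagram.mem_iff_lt_rowLen.2 hj', by lia⟩
      · exact ⟨YoungDiagram.mem_iff_lt_colLen.2 hi', by lia⟩
  rw [this, Finset.card_union_of_disjoint, Finset.card_image_of_injective,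
    Finset.card_image_of_injective, Nat.card_Ico, Nat.card_Ico]
  · simp only [armLength, legLength]; lia
  · exact fun a b hab => (Prod.mk.inj hab).1
  · exact fun a b hab => (Prod.mk.inj hab).2
  · rw [Finset.disjoint_left]
    simp only [Finset.mem_image, Finset.mem_Ico]
    rintro _ ⟨j, -, rfl⟩ ⟨i, hi, he⟩
    have := (Prod.mk.inj he).1
    lia

/-- The size of a partition in Frobenius coordinates. -/
theorem card_eq_sum_arms_add_sum_legs (μ : YoungDiagram) :
    μ.card = ∑ a ∈ arms μ, a + ∑ l ∈ legs μ, (l + 1) := by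
  rw [arms, legs, Finset.sum_image (armLength_injOn μ), Finset.sum_image (legLength_injOn μ),
    ← Finset.sum_add_distrib, YoungDiagram.card,
    Finset.card_eq_sum_card_fiberwise (t := diagonal μ)
      (f := fun c => (min c.1 c.2, min c.1 c.2))]
  · refine Finset.sum_congr rfl ?_
    rintro ⟨d, d'⟩ hd
    obtain ⟨h, rfl : d = d'⟩ := mem_diagonal.1 hd
    rw [← card_principal_hook h]
    simp
  · rintro ⟨i, j⟩ hc
    exact mem_diagonal.2 ⟨μ.up_left_mem (min_le_left i j) (min_le_right i j) hc, rfl⟩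

/-! ### The abacus of a 3-core -/

/-- On every runner of the abacus of a `3`-core the beads are the positions below a threshold. -/
theorem IsThreeCore.exists_threshold {μ : YoungDiagram} (h : IsThreeCore μ) (i : Fin 3) :
    ∃ c : ℤ, ∀ q : ℤ, 3 * q + (i : ℕ) ∈ beads μ ↔ q < c := by
  have hi := i.isLt
  have hdown : ∀ (n : ℕ) (q : ℤ), 3 * q + (i : ℕ) ∈ beads μ → 3 * (q - n) + (i : ℕ) ∈ beads μ := by
    intro n
    induction n with
    | zero => intro q hq; simpa using hq
    | succ n ih =>
      intro q hq
      have := isThreeCore_iff.1 h _ (ih q hq)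
      convert this using 1
      push_cast; ring
  obtain ⟨m, hm, hmax⟩ := Int.exists_greatest_of_bdd
    (P := fun q : ℤ => 3 * q + (i : ℕ) ∈ beads μ)
    ⟨max (rowPos μ 0) 0, by
      rintro q ⟨r, hr⟩
      have := (rowPos_strictAnti μ).antitone (Nat.zero_le r)
      lia⟩
    ⟨-1 - μ.colLen 0, by
      have h0 := rowLen_eq_zero (μ := μ) (i := 3 * μ.colLen 0 + 2 - i) (by lia)
      exact ⟨3 * μ.colLen 0 + 2 - i, by simp only [rowPos, h0]; lia⟩⟩
  refine ⟨m + 1, fun q => ⟨fun hq => by have := hmax q hq; lia, fun hq => ?_⟩⟩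
  have := hdown (m - q).toNat m hm
  convert this using 1
  omega

theorem blackBeads_eq {μ : YoungDiagram} {i : Fin 3} {c : ℤ}
    (h : ∀ q : ℤ, 3 * q + (i : ℕ) ∈ beads μ ↔ q < c) :
    blackBeads μ i = (Finset.range c.toNat).image fun q => 3 * q + (i : ℕ) := by
  have hi3 := i.isLt
  ext a
  simp only [blackBeads, Finset.mem_filter, mem_arms, Finset.mem_image, Finset.mem_range]
  constructor
  · rintro ⟨ha, hi⟩
    have hq : ((a / 3 : ℕ) : ℤ) < c := (h _).1 (by convert ha using 1; omega)
    exact ⟨a / 3, by omega, by omega⟩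
  · rintro ⟨q, hq, rfl⟩
    exact ⟨by simpa using (h q).2 (by omega), by omega⟩

theorem whiteBeads_eq {μ : YoungDiagram} {i : Fin 3} {c : ℤ}
    (h : ∀ q : ℤ, 3 * q + (i : ℕ) ∈ beads μ ↔ q < c) :
    whiteBeads μ i = (Finset.range (-c).toNat).image fun q => 3 * q + (2 - (i : ℕ)) := by
  have hi3 := i.isLt
  ext l
  simp only [whiteBeads, Finset.mem_filter, mem_legs, Finset.mem_image, Finset.mem_range]
  constructor
  · rintro ⟨hl, hi⟩
    have hq : ¬ (-1 - ((l / 3 : ℕ) : ℤ) < c) := fun hq => hl (by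
      convert (h _).2 hq using 1; omega)
    exact ⟨l / 3, by omega, by omega⟩
  · rintro ⟨q, hq, rfl⟩
    refine ⟨fun hl => ?_, by omega⟩
    have : (-1 - q : ℤ) < c := (h _).1 (by convert hl using 1; omega)
    omega

theorem card_blackBeads {μ : YoungDiagram} {i : Fin 3} {c : ℤ}
    (h : ∀ q : ℤ, 3 * q + (i : ℕ) ∈ beads μ ↔ q < c) : (blackBeads μ i).card = c.toNat := by
  rw [blackBeads_eq h, Finset.card_image_of_injective _ (fun a b _ => by grind),
    Finset.card_range]

theorem card_whiteBeads {μ : YoungDiagram} {i : Fin 3} {c : ℤ}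
    (h : ∀ q : ℤ, 3 * q + (i : ℕ) ∈ beads μ ↔ q < c) : (whiteBeads μ i).card = (-c).toNat := by
  rw [whiteBeads_eq h, Finset.card_image_of_injective _ (fun a b _ => by grind),
    Finset.card_range]

theorem charVec_eq {μ : YoungDiagram} {i : Fin 3} {c : ℤ}
    (h : ∀ q : ℤ, 3 * q + (i : ℕ) ∈ beads μ ↔ q < c) : charVec μ i = c := by
  simp only [charVec, ← Finset.card_eq_zero, card_whiteBeads h, card_blackBeads h]
  split_ifs <;> lia

/-- The characteristic vector describes the bead set of a `3`-core completely. -/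
theorem IsThreeCore.mem_beads_iff {μ : YoungDiagram} (h : IsThreeCore μ) (i : Fin 3) (q : ℤ) :
    3 * q + (i : ℕ) ∈ beads μ ↔ q < charVec μ i := by
  obtain ⟨c, hc⟩ := h.exists_threshold i
  rw [charVec_eq hc, hc]

theorem IsThreeCore.eq_of_charVec_eq {μ ν : YoungDiagram} (hμ : IsThreeCore μ)
    (hν : IsThreeCore ν) (h : charVec μ = charVec ν) : μ = ν := by
  apply eq_of_beads_eq
  ext t
  have e : t = 3 * (t / 3) + ((⟨(t % 3).toNat, by lia⟩ : Fin 3) : ℕ) := by simp only; lia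
  rw [e, hμ.mem_beads_iff, hν.mem_beads_iff, h]

theorem sum_arms (μ : YoungDiagram) (f : ℕ → ℤ) :
    ∑ a ∈ arms μ, f a = ∑ i : Fin 3, ∑ a ∈ blackBeads μ i, f a := by
  simp only [blackBeads, Finset.sum_filter]
  rw [Finset.sum_comm]
  refine Finset.sum_congr rfl fun a _ => ?_
  have : a % 3 = 0 ∨ a % 3 = 1 ∨ a % 3 = 2 := by lia
  rcases this with h | h | h <;> simp [Fin.sum_univ_three, h]

theorem sum_legs (μ : YoungDiagram) (f : ℕ → ℤ) :
    ∑ l ∈ legs μ, f l = ∑ i : Fin 3, ∑ l ∈ whiteBeads μ i, f l := by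
  simp only [whiteBeads, Finset.sum_filter]
  rw [Finset.sum_comm]
  refine Finset.sum_congr rfl fun l _ => ?_
  have : l % 3 = 0 ∨ l % 3 = 1 ∨ l % 3 = 2 := by lia
  rcases this with h | h | h <;> simp [Fin.sum_univ_three, h]

/-- The bead set has charge `0`: there are as many arms as legs. -/
theorem IsThreeCore.sum_charVec {μ : YoungDiagram} (h : IsThreeCore μ) :
    charVec μ 0 + charVec μ 1 + charVec μ 2 = 0 := by
  have h1 := sum_arms μ fun _ => 1
  have h2 := sum_legs μ fun _ => 1
  have h3 := card_arms_eq_card_legs μ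
  simp only [Finset.sum_const, nsmul_eq_mul, mul_one, Fin.sum_univ_three,
    card_blackBeads (h.mem_beads_iff _), card_whiteBeads (h.mem_beads_iff _)] at h1 h2
  lia

theorem two_mul_sum_range (n : ℕ) (r : ℤ) :
    2 * ∑ q ∈ Finset.range n, (3 * (q : ℤ) + r) = 3 * n * (n - 1) + 2 * r * n := by
  induction n with
  | zero => simp
  | succ n ih => rw [Finset.sum_range_succ, mul_add, ih]; push_cast; ring

/-- The contribution of one runner to the size; the same quadratic polynomial in `cᵢ` serves
both signs, since only one of the two sums is nonempty. -/
theorem IsThreeCore.two_mul_runner_sum {μ : YoungDiagram} (h : IsThreeCore μ) (i : Fin 3) :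
    2 * (∑ a ∈ blackBeads μ i, (a : ℤ) + ∑ l ∈ whiteBeads μ i, ((l : ℤ) + 1)) =
      3 * charVec μ i * (charVec μ i - 1) + 2 * (i : ℕ) * charVec μ i := by
  rw [blackBeads_eq (h.mem_beads_iff i), whiteBeads_eq (h.mem_beads_iff i),
    Finset.sum_image (fun a _ b _ _ => by grind), Finset.sum_image (fun a _ b _ _ => by grind)]
  have hi3 := i.isLt
  have e1 : ∀ q : ℕ, ((3 * q + (i : ℕ) : ℕ) : ℤ) = 3 * (q : ℤ) + (i : ℕ) :=
    fun q => by push_cast; rfl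
  have e2 : ∀ q : ℕ, ((3 * q + (2 - (i : ℕ)) : ℕ) : ℤ) + 1 = 3 * (q : ℤ) + (3 - (i : ℕ)) :=
    fun q => by lia
  simp only [e1, e2, mul_add, two_mul_sum_range]
  rcases le_total 0 (charVec μ i) with hc | hc
  · rw [Int.toNat_of_nonneg hc, Int.toNat_of_nonpos (by lia)]; push_cast; ring
  · rw [Int.toNat_of_nonneg (a := -charVec μ i) (by lia), Int.toNat_of_nonpos hc]; push_cast; ring

/-- The size of a `3`-core, computed from its Frobenius coordinates runner by runner. -/
theorem IsThreeCore.card_eq_coreSize {μ : YoungDiagram} (h : IsThreeCore μ) :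
    (μ.card : ℤ) = coreSize (charVec μ 1, charVec μ 2) := by
  have h1 : (μ.card : ℤ) = ∑ a ∈ arms μ, (a : ℤ) + ∑ l ∈ legs μ, ((l : ℤ) + 1) := by
    rw [card_eq_sum_arms_add_sum_legs]; push_cast; rfl
  rw [sum_arms, sum_legs, ← Finset.sum_add_distrib, Fin.sum_univ_three] at h1
  have r0 := h.two_mul_runner_sum 0
  have r1 := h.two_mul_runner_sum 1
  have r2 := h.two_mul_runner_sum 2
  simp only [Fin.val_zero, Fin.val_one, Fin.val_two] at r0 r1 r2
  push_cast at r0 r1 r2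
  have hs : charVec μ 0 = -charVec μ 1 - charVec μ 2 := by linarith [h.sum_charVec]
  rw [hs] at r0
  have : 2 * (μ.card : ℤ) = 2 * coreSize (charVec μ 1, charVec μ 2) := by
    rw [h1, mul_add, mul_add, r0, r1, r2]; simp only [coreSize]; ring
  lia

/-! ### Reconstruction of a 3-core from its characteristic vector -/

/-- If `f t` counts the elements `≥ t` of a set of integers of charge `0`, then that set is the
bead set of a partition, namely the one with boxes `(i, j)` for `i < f (j - i)`. -/
theorem exists_beads_iff {f : ℤ → ℕ} {T : ℕ} (h₁ : ∀ t, f (t + 1) ≤ f t)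
    (h₂ : ∀ t, f t ≤ f (t + 1) + 1) (h₃ : ∀ t, (T : ℤ) ≤ t → f t = 0)
    (h₄ : ∀ t, t ≤ -(T : ℤ) → (f t : ℤ) = -t) :
    ∃ μ, ∀ t, t ∈ beads μ ↔ f t = f (t + 1) + 1 := by
  have hanti : Antitone f := antitone_int_of_succ_le h₁
  have hmono : Monotone fun t : ℤ => (f t : ℤ) + t := monotone_int_of_le_succ fun t => by
    have := h₂ t; lia
  have hlow (t : ℤ) : -t ≤ f t := by
    have h := hmono (min_le_left t (-(T : ℤ)))
    have h' := h₄ (min t (-(T : ℤ))) (min_le_right _ _)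
    simp only at h; lia
  have hbound {i j : ℕ} (h : i < f (j - i)) : i < 2 * T ∧ j < 2 * T := by
    have ha : -(T : ℤ) < j - i := by
      by_contra hc
      have := h₄ (j - i) (by lia); lia
    have hb : (j : ℤ) - i < T := by
      by_contra hc
      have := h₃ (j - i) (by lia); lia
    have hc := hanti ha.le
    have hd := h₄ (-T) le_rfl
    lia
  let μ : YoungDiagram :=
    { cells := (Finset.range (2 * T) ×ˢ Finset.range (2 * T)).filter
        fun c => c.1 < f (c.2 - c.1)
      isLowerSet := by
        rintro ⟨i, j⟩ ⟨i', j'⟩ ⟨hi : i' ≤ i, hj : j' ≤ j⟩ hc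
        simp only [Finset.coe_filter, Finset.mem_product, Finset.mem_range,
          Set.mem_ofPred_eq] at hc ⊢
        have h : i' < f (j' - i') := by
          have ha := hanti (show (j' : ℤ) - i' ≤ j - i' by lia)
          have hb := hmono (show (j : ℤ) - i ≤ j - i' by lia)
          simp only at hb; lia
        exact ⟨hbound h, h⟩ }
  have hμ {i j : ℕ} : (i, j) ∈ μ ↔ i < f (j - i) := by
    rw [← YoungDiagram.mem_cells]
    simp only [μ, Finset.mem_filter, Finset.mem_product, Finset.mem_range]
    exact ⟨fun h => h.2, fun h => ⟨hbound h, h⟩⟩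
  refine ⟨μ, fun t => ⟨fun ht => ?_, fun ht => ?_⟩⟩
  · by_contra hne
    have heq : f (t + 1) = f t := by have := h₁ t; have := h₂ t; lia
    have hl := hlow t
    refine notMem_beads_iff.2 ⟨(t + f t).toNat, ?_⟩ ht
    have : μ.colLen (t + f t).toNat = f t := by
      apply colLen_eq_of_mem
      · rw [hμ, show ((t + f t).toNat : ℤ) - f t = t by lia]; lia
      · intro i' hi'
        rw [hμ, show ((t + f t).toNat : ℤ) - i' = t + 1 by lia]; lia
    simp only [colPos, this]; lia
  · have hl := hlow (t + 1)
    refine ⟨f (t + 1), ?_⟩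
    -- The row of index `f (t + 1)` has length `t + f t`.
    have hrow : μ.rowLen (f (t + 1)) = (t + f t).toNat := by
      apply le_antisymm
      · have : (f (t + 1), (t + f t).toNat) ∉ μ := by
          rw [hμ, show ((t + f t).toNat : ℤ) - f (t + 1) = t + 1 by lia]; lia
        rw [YoungDiagram.mem_iff_lt_rowLen] at this; lia
      · by_contra hc
        have : (f (t + 1), (t + f t).toNat - 1) ∈ μ := by
          rw [hμ, show (((t + f t).toNat - 1 : ℕ) : ℤ) - f (t + 1) = t by lia]; lia
        rw [YoungDiagram.mem_iff_lt_rowLen] at this; lia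
    simp only [rowPos, hrow]; lia

/-- Every integer vector with sum `0` is the characteristic vector of a `3`-core. -/
theorem exists_isThreeCore_charVec {c : Fin 3 → ℤ} (hc : c 0 + c 1 + c 2 = 0) :
    ∃ μ, IsThreeCore μ ∧ charVec μ = c := by
  -- The number of integers `3 * q + i ≥ t` with `q < c i`.
  let f (t : ℤ) : ℕ :=
    (c 0 - (t + 2) / 3).toNat + (c 1 - (t + 1) / 3).toNat + (c 2 - t / 3).toNat
  obtain ⟨μ, hμ⟩ := exists_beads_iff (f := f)
    (T := 3 * ((c 0).natAbs + (c 1).natAbs + (c 2).natAbs) + 3)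
    (fun t => by simp only [f]; lia) (fun t => by simp only [f]; lia)
    (fun t ht => by simp only [f]; lia) (fun t ht => by simp only [f]; lia)
  have hbead (i : Fin 3) (q : ℤ) : 3 * q + (i : ℕ) ∈ beads μ ↔ q < c i := by
    rw [hμ]
    fin_cases i <;> simp only [f] <;> simp <;> lia
  refine ⟨μ, isThreeCore_iff.2 fun t ht => ?_, funext fun i => charVec_eq (hbead i)⟩
  have e : t = 3 * (t / 3) + ((⟨(t % 3).toNat, by lia⟩ : Fin 3) : ℕ) := by simp only; lia
  rw [e, hbead] at ht
  have := (hbead _ (t / 3 - 1)).2 ((sub_one_lt _).trans ht)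
  convert this using 1
  lia

/-! ### Counting 3-cores -/

theorem C_eq (n : ℕ) : C n = {p | coreSize p = n} := by
  ext ⟨x, y⟩
  constructor
  · rintro ⟨μ, ⟨hμ, hn⟩, h⟩
    have := hμ.card_eq_coreSize
    rw [hn, h] at this
    exact this.symm
  · intro hp
    obtain ⟨μ, hμ, h⟩ := exists_isThreeCore_charVec (c := ![-x - y, x, y])
      (by simp only [Matrix.cons_val]; ring)
    refine ⟨μ, ⟨hμ, ?_⟩, h⟩
    have := hμ.card_eq_coreSize
    rw [h] at this
    exact_mod_cast this.trans hp

theorem a₃_eq_ncard (n : ℕ) : a₃ n = (C n).ncard := by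
  have hvec {μ : YoungDiagram} (hμ : IsThreeCore μ) :
      charVec μ = ![-charVec μ 1 - charVec μ 2, charVec μ 1, charVec μ 2] := by
    have := hμ.sum_charVec
    ext i
    fin_cases i
    · simp; linarith
    · rfl
    · rfl
  have himage : C n = (fun μ => (charVec μ 1, charVec μ 2)) '' cores n := by
    ext ⟨x, y⟩
    constructor
    · rintro ⟨μ, hμ, h⟩
      exact ⟨μ, hμ, by simp [h]⟩
    · rintro ⟨μ, hμ, h⟩
      obtain ⟨rfl, rfl⟩ := Prod.mk.inj h
      exact ⟨μ, hμ, hvec hμ.1⟩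
  rw [himage, Set.InjOn.ncard_image, a₃]
  rintro μ hμ ν hν h
  obtain ⟨h1, h2⟩ := Prod.mk.inj h
  apply hμ.1.eq_of_charVec_eq hν.1
  rw [hvec hμ.1, hvec hν.1, h1, h2]

theorem bijOn_alpha_C {n m : ℕ} (h : Nat.Coprime (3 * n + 1) (3 * m + 1)) :
    Set.BijOn alpha (C n ×ˢ C m) (C (3 * m * n + m + n)) := by
  rw [C_eq, C_eq, C_eq]
  exact bijOn_alpha h

theorem a₃_mul {n m : ℕ} (h : Nat.Coprime (3 * n + 1) (3 * m + 1)) :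
    a₃ (3 * m * n + m + n) = a₃ n * a₃ m := by
  have hb := bijOn_alpha_C h
  rw [a₃_eq_ncard, a₃_eq_ncard, a₃_eq_ncard, ← Set.ncard_prod, ← hb.image_eq,
    hb.injOn.ncard_image]

/-- The difference of `3 * (n + 3 ^ k) + 1` and `3 * n + 1` is a power of `3`. -/
theorem coprime_three_mul_add_one (n k : ℕ) :
    Nat.Coprime (3 * n + 1) (3 * (n + 3 ^ k) + 1) := by
  have e : 3 * (n + 3 ^ k) + 1 = 3 ^ (k + 1) + (3 * n + 1) := by ring
  rw [e, Nat.coprime_add_self_right]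
  apply Nat.Coprime.pow_right
  simp

end ThreeCore

theorem mainTheorem4 :
    (∀ n k : ℕ, 1 ≤ n →
      ThreeCore.a₃ (3 * n ^ 2 + (3 ^ (k + 1) + 2) * n + 3 ^ k) =
        ThreeCore.a₃ n * ThreeCore.a₃ (n + 3 ^ k)) ∧
    (∀ n k : ℕ, 1 ≤ n →
      Set.BijOn ThreeCore.alpha (ThreeCore.C n ×ˢ ThreeCore.C (n + 3 ^ k))
        (ThreeCore.C (3 * n ^ 2 + (3 ^ (k + 1) + 2) * n + 3 ^ k))) ∧
    (∀ n m : ℕ, Nat.Coprime (3 * n + 1) (3 * m + 1) →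
      ThreeCore.a₃ (3 * m * n + m + n) = ThreeCore.a₃ n * ThreeCore.a₃ m) := by
  have e (n k : ℕ) : 3 * n ^ 2 + (3 ^ (k + 1) + 2) * n + 3 ^ k =
      3 * (n + 3 ^ k) * n + (n + 3 ^ k) + n := by ring
  refine ⟨fun n k _ => ?_, fun n k _ => ?_, fun n m h => ThreeCore.a₃_mul h⟩
  · rw [e]; exact ThreeCore.a₃_mul (ThreeCore.coprime_three_mul_add_one n k)
  · rw [e]; exact ThreeCore.bijOn_alpha_C (ThreeCore.coprime_three_mul_add_one n k)
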